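/- Let $P_0,P_1,P_2,P_3\in\mathbb R^3$ be affinely independent (the vertices of a tetrahedron), let $f_i(X)=\tfrac12(X+P_i)$, $0\le i\le 3$, and for a word $w=(w_1,\dots,w_m)\in\{0,1,2,3\}^m$ let $f_w=f_{w_1}\circ\dots\circ f_{w_m}$. Put $V_0=\{P_0,\dots,P_3\}$ and $V_{m}=\bigcup_{i=0}^3 f_i(V_{m-1})$ for $m\ge 1$; one has $V_{m-1}\subset V_m$. Two distinct points $X,Y\in V_m$ are adjacent, $X\sim_m Y$, if both belong to $f_w(V_0)$ for some word $w$ of length $m$. For $u:V_m\to\mathbb R$ let $\Delta_m u(X)=\sum_{Y\sim_m X}(u(Y)-u(X))$ for $X\in V_m\setminus V_0$. For $\lambda\in\mathbb R$ let $E_m(\lambda)$ be the space of all $u:V_m\to\mathbb R$ with $u=0$ on $V_0$ and $-\Delta_m u=\lambda u$ on $V_m\setminus V_0$, let $M_m(\lambda)=\dim E_m(\lambda)$, and let $\sigma_m=\{\lambda\in\mathbb R: E_m(\lambda)\ne\{0\}\}$ be the Dirichlet spectrum of level $m$. (1) For every $m\ge1$: $\#(V_m\setminus V_0)=2(4^m-1)$;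 the Dirichlet spectrum is complete, i.e. $\sigma_m$ is finite, the spaces $E_m(\lambda)$ span the space of all functions on $V_m$ vanishing on $V_0$, and $\sum_{\lambda\in\sigma_m}M_m(\lambda)=2(4^m-1)$; moreover $M_m(8)=4^m-2$, $M_m(6)=4^{m-1}+2$, and $2\in\sigma_m$ if and only if $m=1$. (2) (The remaining eigenvalues come from spectral decimation.) Let $m\ge1$. If $\lambda\in\mathbb R\setminus\{2,6,8\}$, then restriction to $V_m$ is a bijection from $E_{m+1}(\lambda)$ onto $E_m(\lambda(6-\lambda))$, so $M_{m+1}(\lambda)=M_m(\lambda(6-\lambda))$. Every $\mu\in\sigma_m$ satisfies $\mu<9$; one has $M_{m+1}(3+\sqrt{9-\mu})=M_m(\mu)$, and, if $\mu\neq8$, also $M_{m+1}(3-\sqrt{9-\mu})=M_m(\mu)$. Furthermore $$\sigma_{m+1}=\{6,8\}\cup\bigl(\{3\pm\sqrt{9-\mu}:\mu\in\sigma_m\}\setminus\{2\}\bigr).$$ The eigenvalues of level $m$ other than $8$ number $4^m$ counted with multiplicity, and the eigenvalues of level $m+1$ other than $6$ and $8$ number $(4^m-2)+2\cdot4^m$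 counted with multiplicity. (3) For $m=1$ the eigenvalues are exactly $2,8,6$, with multiplicities $1,2,3$. (4) For $m=2$ the eigenvalues are exactly $6,\ 8,\ 3-\sqrt7,\ 3+\sqrt7,\ 3-\sqrt3,\ 3+\sqrt3,\ 4$, with multiplicities $6,\ 14,\ 1,\ 1,\ 3,\ 3,\ 2$ respectively. -/

import Mathlib

namespace SierpinskiTetrahedron

/-- Euclidean three-space. -/
abbrev Space : Type := EuclideanSpace ℝ (Fin 3)

/-- The contraction `f_i(X) = (X + P_i) / 2`. -/
noncomputable def contraction (P : Fin 4 → Space) (i : Fin 4) (X : Space) : Space :=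
  (1 / 2 : ℝ) • (X + P i)

/-- For a word `w = (w_1, …, w_m)`, the map `f_w = f_{w_1} ∘ ⋯ ∘ f_{w_m}`. -/
noncomputable def wordMap (P : Fin 4 → Space) : List (Fin 4) → Space → Space
  | [] => id
  | i :: w => contraction P i ∘ wordMap P w

open Classical in
/-- The vertex sets: `V_0 = {P_0, …, P_3}` and `V_{m+1} = ⋃ i, f_i(V_m)`. -/
noncomputable def vertices (P : Fin 4 → Space) : ℕ → Finset Space
  | 0 => Finset.univ.image P
  | m + 1 => Finset.univ.biUnion fun i : Fin 4 => (vertices P m).image (contraction P i)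

theorem vertices_subset_succ (P : Fin 4 → Space) (m : ℕ) :
    vertices P m ⊆ vertices P (m + 1) := by
  classical
  induction m with
  | zero =>
    intro X hX
    obtain ⟨i, -, rfl⟩ := Finset.mem_image.1 hX
    refine Finset.mem_biUnion.2 ⟨i, Finset.mem_univ _, Finset.mem_image.2 ⟨P i, hX, ?_⟩⟩
    rw [contraction, ← two_smul ℝ (P i), smul_smul]
    norm_num
  | succ m ih =>
    intro X hX
    obtain ⟨i, hi, hX⟩ := Finset.mem_biUnion.1 hX
    exact Finset.mem_biUnion.2 ⟨i, hi, Finset.image_subset_image ih hX⟩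

/-- The graph of level `m` on `V_m`: two distinct points are adjacent when both belong to one cell
`f_w(V_0)` with `w` a word of length `m`. -/
def graph (P : Fin 4 → Space) (m : ℕ) : SimpleGraph (vertices P m) where
  Adj X Y := X ≠ Y ∧ ∃ w : List (Fin 4), w.length = m ∧
    ∃ j k : Fin 4, (X : Space) = wordMap P w (P j) ∧ (Y : Space) = wordMap P w (P k)
  symm := ⟨by
    rintro X Y ⟨h, w, hw, j, k, hX, hY⟩
    exact ⟨h.symm, w, hw, k, j, hY, hX⟩⟩
  loopless := ⟨fun X h => h.1 rfl⟩

open Classical in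
/-- The graph Laplacian `Δ_m u(X) = ∑_{Y ∼ X} (u(Y) - u(X))`. (It is only used at the points `X`
of `V_m ∖ V_0`.) -/
noncomputable def laplacian (P : Fin 4 → Space) (m : ℕ) (u : vertices P m → ℝ)
    (X : vertices P m) : ℝ :=
  ∑ Y : vertices P m with (graph P m).Adj X Y, (u Y - u X)

/-- The functions on `V_m` that vanish on the boundary `V_0`. -/
def dirichletFunctions (P : Fin 4 → Space) (m : ℕ) : Submodule ℝ (vertices P m → ℝ) where
  carrier := {u | ∀ X : vertices P m, (X : Space) ∈ vertices P 0 → u X = 0}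
  zero_mem' := fun _ _ => rfl
  add_mem' := by
    intro u v hu hv X hX
    simp [hu X hX, hv X hX]
  smul_mem' := by
    intro c u hu X hX
    simp [hu X hX]

/-- The Dirichlet eigenspace of `-Δ_m` for `lam`: the functions `u` on `V_m` with `u = 0` on `V_0`
and `-Δ_m u = lam * u` on `V_m ∖ V_0`. -/
noncomputable def dirichletEigenspace (P : Fin 4 → Space) (m : ℕ) (lam : ℝ) :
    Submodule ℝ (vertices P m → ℝ) where
  carrier := {u | u ∈ dirichletFunctions P m ∧
    ∀ X : vertices P m, (X : Space) ∉ vertices P 0 → -laplacian P m u X = lam * u X}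
  zero_mem' := ⟨Submodule.zero_mem _, fun X _ => by simp [laplacian]⟩
  add_mem' := by
    rintro u v ⟨hu, hu'⟩ ⟨hv, hv'⟩
    refine ⟨Submodule.add_mem _ hu hv, fun X hX => ?_⟩
    have h : laplacian P m (u + v) X = laplacian P m u X + laplacian P m v X := by
      simp only [laplacian, ← Finset.sum_add_distrib, Pi.add_apply]
      exact Finset.sum_congr rfl fun Y _ => by ring
    rw [h, neg_add, hu' X hX, hv' X hX, Pi.add_apply, mul_add]
  smul_mem' := by
    rintro c u ⟨hu, hu'⟩
    refine ⟨Submodule.smul_mem _ c hu, fun X hX => ?_⟩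
    have h : laplacian P m (c • u) X = c * laplacian P m u X := by
      simp only [laplacian, Finset.mul_sum, Pi.smul_apply, smul_eq_mul]
      exact Finset.sum_congr rfl fun Y _ => by ring
    rw [h, Pi.smul_apply, smul_eq_mul, ← mul_neg, hu' X hX]
    ring

/-- The set of Dirichlet eigenvalues of `-Δ_m`. -/
def dirichletSpectrum (P : Fin 4 → Space) (m : ℕ) : Set ℝ :=
  {lam | ∃ u ∈ dirichletEigenspace P m lam, u ≠ 0}

/-- The multiplicity `M_m(lam)`: the dimension of the Dirichlet eigenspace. -/
noncomputable def multiplicity (P : Fin 4 → Space) (m : ℕ) (lam : ℝ) : ℕ :=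
  Module.finrank ℝ (dirichletEigenspace P m lam)

/-- The restriction to `V_m` of a function on `V_{m+1}`. -/
def restrict (P : Fin 4 → Space) (m : ℕ) (u : vertices P (m + 1) → ℝ) : vertices P m → ℝ :=
  fun X => u ⟨X, vertices_subset_succ P m X.2⟩

end SierpinskiTetrahedron

/-! Write S(c) for the sum of u over the four corners of a cell c. Affine independence makes every
interior vertex lie in exactly two cells, and two distinct cells share at most one vertex, so -Δu(X)
= 8u(X) - S(c) - S(c') and the eigenvalue equation reads (8-λ)u(X) = S(c) + S(c').

Let S_i be the sums over the children of a cell c with corners x_i, and T(c) = ∑ S_i. The equations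
at the midpoints give (8-λ)u(x_ij) = S_i + S_j, then (6-λ)S_i = (8-λ)u(x_i) + T(c) and (2-λ)T(c) =
(8-λ)S(c). At an old vertex (4-λ)(8-λ)u(X) = T(c) + T(c'). As (2-λ)(4-λ) = 8 - λ(6-λ), this is the
level m equation for λ(6-λ), and away from 2, 6, 8 every step can be reversed (`IsEig.decimate`,
`IsEig.eq_zero_of_decimate`, `IsEig.decimationExtension`).

The exceptional values rest on one remark: siblings meet pairwise, so a cell function whose sums
over the cells at interior vertices vanish is zero (`eq_zero_of_sum_incidences`). It identifies the
eigenspace of 8 with the kernel of the cell sums, shows that these are onto, and with an energy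
identity excludes 2 beyond level one. Since -Δ is symmetric, the multiplicities add up to the
dimension, and the multiplicity of 6 is what remains. -/

namespace SierpinskiTetrahedron

/-! ### Cells, corners and words -/

/-- The cells of level `m`, indexed by words whose last letter is added last. -/
def Cell : ℕ → Type
  | 0 => Unit
  | m + 1 => Cell m × Fin 4

instance Cell.instFintype : (m : ℕ) → Fintype (Cell m)
  | 0 => inferInstanceAs (Fintype Unit)
  | m + 1 => haveI := Cell.instFintype m; inferInstanceAs (Fintype (Cell m × Fin 4))

instance Cell.instDecidableEq : (m : ℕ) → DecidableEq (Cell m)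
  | 0 => inferInstanceAs (DecidableEq Unit)
  | m + 1 => haveI := Cell.instDecidableEq m; inferInstanceAs (DecidableEq (Cell m × Fin 4))

/-- The subcell of `c` at its `i`-th corner. -/
def Cell.child {m : ℕ} (c : Cell m) (i : Fin 4) : Cell (m + 1) := (c, i)

theorem Cell.exists_child {m : ℕ} (c : Cell (m + 1)) : ∃ (d : Cell m) (i : Fin 4), c = d.child i :=
  ⟨c.1, c.2, rfl⟩

theorem Cell.child_inj {m : ℕ} {c d : Cell m} {i j : Fin 4} :
    c.child i = d.child j ↔ c = d ∧ i = j := Prod.mk.injEq _ _ _ _ ▸ Iff.rfl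

theorem card_cell (m : ℕ) : Fintype.card (Cell m) = 4 ^ m := by
  induction m with
  | zero => rfl
  | succ m ih =>
    have : Fintype.card (Cell (m + 1)) = Fintype.card (Cell m × Fin 4) := rfl
    rw [this, Fintype.card_prod, ih, Fintype.card_fin, pow_succ]

/-- The `j`-th corner of a cell. -/
noncomputable def corner (P : Fin 4 → Space) : (m : ℕ) → Cell m → Fin 4 → Space
  | 0, _, j => P j
  | m + 1, c, j => (1 / 2 : ℝ) • (corner P m c.1 c.2 + corner P m c.1 j)

/-- The word of a cell. -/
def Cell.word : (m : ℕ) → Cell m → List (Fin 4)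
  | 0, _ => []
  | m + 1, c => Cell.word m c.1 ++ [c.2]

/-- Integer barycentric coordinates of a cell. -/
def address : (m : ℕ) → Cell m → Fin 4 → ℕ
  | 0, _, _ => 0
  | m + 1, c, k => 2 * address m c.1 k + if k = c.2 then 1 else 0

theorem corner_child (P : Fin 4 → Space) {m : ℕ} (c : Cell m) (i j : Fin 4) :
    corner P (m + 1) (c.child i) j = (1 / 2 : ℝ) • (corner P m c i + corner P m c j) := rfl

theorem corner_child_self (P : Fin 4 → Space) {m : ℕ} (c : Cell m) (i : Fin 4) :
    corner P (m + 1) (c.child i) i = corner P m c i := by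
  rw [corner_child, ← two_smul ℝ (corner P m c i), smul_smul]
  norm_num

theorem corner_child_comm (P : Fin 4 → Space) {m : ℕ} (c : Cell m) (i j : Fin 4) :
    corner P (m + 1) (c.child i) j = corner P (m + 1) (c.child j) i := by
  rw [corner_child, corner_child, add_comm]

theorem address_child {m : ℕ} (c : Cell m) (i k : Fin 4) :
    address (m + 1) (c.child i) k = 2 * address m c k + if k = i then 1 else 0 := rfl

theorem wordMap_append (P : Fin 4 → Space) (w v : List (Fin 4)) (X : Space) :
    wordMap P (w ++ v) X = wordMap P w (wordMap P v X) := by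
  induction w with
  | nil => rfl
  | cons i w ih => simp [wordMap, ih]

theorem wordMap_midpoint (P : Fin 4 → Space) (w : List (Fin 4)) (X Y : Space) :
    wordMap P w ((1 / 2 : ℝ) • (X + Y)) = (1 / 2 : ℝ) • (wordMap P w X + wordMap P w Y) := by
  induction w with
  | nil => rfl
  | cons i w ih =>
    simp only [wordMap, Function.comp_apply, ih, contraction]
    module

/-- Appending a letter i to w replaces P_j by the midpoint of P_i and P_j, and f_w preserves
midpoints; hence the recursion defining `corner`. -/
theorem wordMap_word (P : Fin 4 → Space) {m : ℕ} (c : Cell m) (j : Fin 4) :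
    wordMap P (c.word m) (P j) = corner P m c j := by
  induction m generalizing j with
  | zero => rfl
  | succ m ih =>
    obtain ⟨d, i, rfl⟩ := c.exists_child
    have h : wordMap P [i] (P j) = (1 / 2 : ℝ) • (P i + P j) := by
      simp [wordMap, contraction, add_comm]
    rw [corner_child, ← ih d i, ← ih d j, ← wordMap_midpoint, ← h, ← wordMap_append]
    rfl

theorem length_word {m : ℕ} (c : Cell m) : (c.word m).length = m := by
  induction m with
  | zero => rfl
  | succ m ih => simp [Cell.word, ih]

theorem exists_word_eq {m : ℕ} (w : List (Fin 4)) (hw : w.length = m) :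
    ∃ c : Cell m, c.word m = w := by
  induction m generalizing w with
  | zero => exact ⟨(), (List.length_eq_zero_iff.1 hw).symm⟩
  | succ m ih =>
    rcases List.eq_nil_or_concat w with rfl | ⟨v, i, rfl⟩
    · simp at hw
    · obtain ⟨c, rfl⟩ := ih v (by simpa using hw)
      exact ⟨c.child i, by simp [Cell.word, Cell.child]⟩

theorem mem_vertices_iff_wordMap (P : Fin 4 → Space) (m : ℕ) (X : Space) :
    X ∈ vertices P m ↔ ∃ w : List (Fin 4), w.length = m ∧ ∃ j, wordMap P w (P j) = X := by
  classical
  induction m generalizing X with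
  | zero => simp [vertices, wordMap]
  | succ m ih =>
    simp only [vertices, Finset.mem_biUnion, Finset.mem_univ, true_and, Finset.mem_image, ih]
    constructor
    · rintro ⟨i, _, ⟨w, rfl, j, rfl⟩, rfl⟩
      exact ⟨i :: w, rfl, j, rfl⟩
    · rintro ⟨w, hw, j, rfl⟩
      match w, hw with
      | i :: w, hw => exact ⟨i, _, ⟨w, by simpa using hw, j, rfl⟩, rfl⟩

theorem mem_vertices_iff (P : Fin 4 → Space) (m : ℕ) (X : Space) :
    X ∈ vertices P m ↔ ∃ (c : Cell m) (j : Fin 4), corner P m c j = X := by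
  rw [mem_vertices_iff_wordMap]
  constructor
  · rintro ⟨w, hw, j, rfl⟩
    obtain ⟨c, rfl⟩ := exists_word_eq w hw
    exact ⟨c, j, (wordMap_word P c j).symm⟩
  · rintro ⟨c, j, rfl⟩
    exact ⟨c.word m, length_word c, j, wordMap_word P c j⟩

theorem corner_mem (P : Fin 4 → Space) {m : ℕ} (c : Cell m) (j : Fin 4) :
    corner P m c j ∈ vertices P m := (mem_vertices_iff P m _).2 ⟨c, j, rfl⟩

theorem vertices_zero_subset (P : Fin 4 → Space) (m : ℕ) : vertices P 0 ⊆ vertices P m := by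
  induction m with
  | zero => exact subset_rfl
  | succ m ih => exact ih.trans (vertices_subset_succ P m)

/-! ### Barycentric addresses and coincidence of corners -/

theorem sum_address {m : ℕ} (c : Cell m) : ∑ k, address m c k + 1 = 2 ^ m := by
  induction m with
  | zero => simp [address]
  | succ m ih =>
    obtain ⟨d, i, rfl⟩ := c.exists_child
    simp only [address_child, Finset.sum_add_distrib, ← Finset.mul_sum, Finset.sum_ite_eq',
      Finset.mem_univ, if_true]
    have := ih d
    rw [pow_succ]
    omega

theorem two_pow_smul_corner (P : Fin 4 → Space) {m : ℕ} (c : Cell m) (j : Fin 4) :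
    (2 ^ m : ℝ) • corner P m c j
      = ∑ k, (address m c k + if k = j then 1 else 0 : ℝ) • P k := by
  induction m generalizing j with
  | zero => simp [address, corner, ite_smul]
  | succ m ih =>
    obtain ⟨d, i, rfl⟩ := c.exists_child
    have h : (2 ^ (m + 1) : ℝ) • corner P (m + 1) (d.child i) j
        = (2 ^ m : ℝ) • corner P m d i + (2 ^ m : ℝ) • corner P m d j := by
      rw [corner_child, pow_succ]
      module
    rw [h, ih, ih, ← Finset.sum_add_distrib]
    refine Finset.sum_congr rfl fun k _ => ?_
    rw [← add_smul, address_child]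
    push_cast
    congr 1
    ring

/-- Scaled by 2^m, both corners are integer combinations of the P_l with the same total weight, so
affine independence compares coefficients. -/
theorem corner_eq_iff {P : Fin 4 → Space} (hP : AffineIndependent ℝ P) {m : ℕ} {c d : Cell m}
    {j k : Fin 4} : corner P m c j = corner P m d k ↔
      ∀ l, (address m c l + if l = j then 1 else 0) = address m d l + if l = k then 1 else 0 := by
  constructor
  · intro h
    have h1 := congrArg (fun X => (2 ^ m : ℝ) • X) h
    simp only [two_pow_smul_corner] at h1
    have hc := sum_address c
    have hd := sum_address d
    have hcd : (∑ l, (address m c l : ℝ)) = ∑ l, (address m d l : ℝ) := by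
      have : ∑ l, address m c l = ∑ l, address m d l := by omega
      exact_mod_cast this
    have key := (affineIndependent_iff.1 hP) Finset.univ
      (fun l => (address m c l + if l = j then 1 else 0 : ℝ)
        - (address m d l + if l = k then 1 else 0 : ℝ))
      (by simp [Finset.sum_add_distrib, hcd])
      (by simp only [sub_smul, Finset.sum_sub_distrib, h1, sub_self])
    intro l
    have := sub_eq_zero.1 (key l (Finset.mem_univ l))
    exact_mod_cast this
  · intro h
    have h1 : (2 ^ m : ℝ) • corner P m c j = (2 ^ m : ℝ) • corner P m d k := by
      rw [two_pow_smul_corner, two_pow_smul_corner]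
      refine Finset.sum_congr rfl fun l _ => ?_
      have := congrArg (Nat.cast : ℕ → ℝ) (h l)
      push_cast at this
      rw [this]
    exact smul_right_injective _ (by positivity) h1

/-- The last letter is the only index with an odd coordinate; halving recovers the parent. -/
theorem address_injective (m : ℕ) : Function.Injective (address m) := by
  induction m with
  | zero => intro c d _; rfl
  | succ m ih =>
    intro c d h
    obtain ⟨c, i, rfl⟩ := c.exists_child
    obtain ⟨d, j, rfl⟩ := d.exists_child
    have hij : i = j := by
      have := congrFun h i
      simp only [address_child, if_true] at this
      by_contra hne
      rw [if_neg hne] at this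
      omega
    subst hij
    have : c = d := ih (funext fun k => by
      have := congrFun h k
      simp only [address_child] at this
      omega)
    rw [this]

theorem corner_injective {P : Fin 4 → Space} (hP : AffineIndependent ℝ P) {m : ℕ} (c : Cell m) :
    Function.Injective (corner P m c) := by
  intro j k h
  have := (corner_eq_iff hP).1 h j
  simp only [if_true] at this
  by_contra hne
  rw [if_neg hne] at this
  omega

/-- Distinct cells share at most one vertex; this keeps a neighbour from being counted twice in the
Laplacian. -/
theorem cell_eq_of_two_corners {P : Fin 4 → Space} (hP : AffineIndependent ℝ P) {m : ℕ}
    {c d : Cell m} {j j' k k' : Fin 4} (hne : j ≠ j') (h : corner P m c j = corner P m d k)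
    (h' : corner P m c j' = corner P m d k') : c = d := by
  have h1 := (corner_eq_iff hP).1 h
  have h2 := (corner_eq_iff hP).1 h'
  have hjk : j = k := by
    have a := h1 j
    have b := h2 j
    by_contra hne'
    simp only [if_true, if_neg hne, if_neg hne'] at a b
    omega
  subst hjk
  exact address_injective m (funext fun l => by have := h1 l; omega)

/-- The scaled coordinates of a midpoint are odd exactly at i and j. Parity thus recovers the
unordered pair, and the remaining even part recovers the parent cell. -/
theorem corner_child_eq_iff {P : Fin 4 → Space} (hP : AffineIndependent ℝ P) {m : ℕ}
    {c d : Cell m} {i j k l : Fin 4} (hij : i ≠ j) :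
    corner P (m + 1) (d.child k) l = corner P (m + 1) (c.child i) j ↔
      d = c ∧ (k = i ∧ l = j ∨ k = j ∧ l = i) := by
  constructor
  · intro h
    have h1 := (corner_eq_iff hP).1 h
    simp only [address_child] at h1
    have hkl : k = i ∧ l = j ∨ k = j ∧ l = i := by
      have hi := h1 i
      have hj := h1 j
      simp only [if_true, if_neg hij, if_neg hij.symm] at hi hj
      by_cases a : i = k <;> by_cases b : i = l <;> by_cases a' : j = k <;> by_cases b' : j = l <;>
        simp only [if_pos, a, b, a', b', if_false] at hi hj <;> omega
    refine ⟨address_injective m (funext fun n => ?_), hkl⟩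
    have := h1 n
    rcases hkl with ⟨rfl, rfl⟩ | ⟨rfl, rfl⟩ <;> omega
  · rintro ⟨rfl, ⟨rfl, rfl⟩ | ⟨rfl, rfl⟩⟩
    · rfl
    · exact corner_child_comm _ _ _ _

theorem corner_child_notMem {P : Fin 4 → Space} (hP : AffineIndependent ℝ P) {m : ℕ}
    (c : Cell m) {i j : Fin 4} (hij : i ≠ j) :
    corner P (m + 1) (c.child i) j ∉ vertices P m := by
  intro h
  obtain ⟨d, k, hd⟩ := (mem_vertices_iff P m _).1 h
  rw [← corner_child_self, corner_child_eq_iff hP hij] at hd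
  rcases hd with ⟨-, ⟨h₁, h₂⟩ | ⟨h₁, h₂⟩⟩
  · exact hij (h₁.symm.trans h₂)
  · exact hij (h₂.symm.trans h₁)

/-! ### Incidences between vertices and cells -/

/-- The pairs of a cell and an index of a corner located at `X`. -/
noncomputable def incidences (P : Fin 4 → Space) (m : ℕ) (X : Space) : Finset (Cell m × Fin 4) :=
  open Classical in Finset.univ.filter fun p => corner P m p.1 p.2 = X

theorem mem_incidences {P : Fin 4 → Space} {m : ℕ} {X : Space} {p : Cell m × Fin 4} :
    p ∈ incidences P m X ↔ corner P m p.1 p.2 = X := by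
  simp [incidences]

theorem incidences_child {P : Fin 4 → Space} (hP : AffineIndependent ℝ P) {m : ℕ} (c : Cell m)
    {i j : Fin 4} (hij : i ≠ j) :
    incidences P (m + 1) (corner P (m + 1) (c.child i) j)
      = {(c.child i, j), (c.child j, i)} := by
  ext ⟨e, l⟩
  obtain ⟨d, k, rfl⟩ := e.exists_child
  rw [mem_incidences, corner_child_eq_iff hP hij]
  simp only [Finset.mem_insert, Finset.mem_singleton, Prod.mk.injEq, Cell.child_inj]
  tauto

theorem sum_incidences_child {P : Fin 4 → Space} (hP : AffineIndependent ℝ P) {m : ℕ}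
    (c : Cell m) {i j : Fin 4} (hij : i ≠ j) (F : Cell (m + 1) × Fin 4 → ℝ) :
    ∑ p ∈ incidences P (m + 1) (corner P (m + 1) (c.child i) j), F p
      = F (c.child i, j) + F (c.child j, i) := by
  rw [incidences_child hP c hij, Finset.sum_pair]
  simp [Cell.child_inj, hij]

/-- An old vertex stays in as many cells as before: each cell at it is replaced by the child at that
corner. -/
theorem incidences_of_mem {P : Fin 4 → Space} (hP : AffineIndependent ℝ P) {m : ℕ} {X : Space}
    (hX : X ∈ vertices P m) :
    incidences P (m + 1) X = (incidences P m X).image fun p => (p.1.child p.2, p.2) := by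
  ext ⟨e, l⟩
  obtain ⟨d, k, rfl⟩ := e.exists_child
  simp only [mem_incidences, Finset.mem_image, Prod.mk.injEq, Cell.child_inj, Prod.exists]
  constructor
  · rintro rfl
    by_cases hkl : k = l
    · subst hkl
      exact ⟨d, k, (corner_child_self P d k).symm, ⟨rfl, rfl⟩, rfl⟩
    · exact absurd hX (corner_child_notMem hP d hkl)
  · rintro ⟨c, j, rfl, ⟨rfl, rfl⟩, rfl⟩
    exact corner_child_self P _ _

theorem child_self_injective (m : ℕ) :
    Function.Injective fun p : Cell m × Fin 4 => ((p.1.child p.2, p.2) : Cell (m + 1) × Fin 4) := by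
  rintro ⟨c, i⟩ ⟨d, j⟩ h
  simp only [Prod.mk.injEq, Cell.child_inj] at h
  exact Prod.ext h.1.1 h.2

theorem sum_incidences_of_mem {P : Fin 4 → Space} (hP : AffineIndependent ℝ P) {m : ℕ} {X : Space}
    (hX : X ∈ vertices P m) (F : Cell (m + 1) × Fin 4 → ℝ) :
    ∑ p ∈ incidences P (m + 1) X, F p = ∑ p ∈ incidences P m X, F (p.1.child p.2, p.2) := by
  rw [incidences_of_mem hP hX, Finset.sum_image fun p _ q _ h => child_self_injective m h]

/-- New vertices are midpoints, shared by exactly two siblings, and incidence numbers persist from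
level to level. -/
theorem card_incidences {P : Fin 4 → Space} (hP : AffineIndependent ℝ P) (m : ℕ) {X : Space}
    (hX : X ∈ vertices P m) :
    (X ∈ vertices P 0 → (incidences P m X).card = 1) ∧
      (X ∉ vertices P 0 → (incidences P m X).card = 2) := by
  induction m with
  | zero =>
    refine ⟨fun _ => ?_, fun h => absurd hX h⟩
    obtain ⟨c, j, rfl⟩ := (mem_vertices_iff P 0 X).1 hX
    refine Finset.card_eq_one.2 ⟨(c, j), ?_⟩
    ext ⟨d, k⟩
    obtain rfl : d = c := rfl
    simp [mem_incidences, (corner_injective hP d).eq_iff]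
  | succ m ih =>
    by_cases h : X ∈ vertices P m
    · rw [incidences_of_mem hP h, Finset.card_image_of_injective _ (child_self_injective m)]
      exact ih h
    · refine ⟨fun h0 => absurd (vertices_zero_subset P m h0) h, fun _ => ?_⟩
      obtain ⟨e, j, rfl⟩ := (mem_vertices_iff P (m + 1) X).1 hX
      obtain ⟨c, i, rfl⟩ := e.exists_child
      have hij : i ≠ j := by
        rintro rfl
        rw [corner_child_self] at h
        exact h (corner_mem P c i)
      rw [incidences_child hP c hij, Finset.card_pair]
      simp [Cell.child_inj, hij]

theorem sum_vertices_incidences (P : Fin 4 → Space) (m : ℕ) (F : Cell m × Fin 4 → ℝ) :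
    ∑ X ∈ vertices P m, ∑ p ∈ incidences P m X, F p = ∑ c, ∑ j, F (c, j) := by
  classical
  rw [← Fintype.sum_prod_type]
  simp only [incidences]
  convert Finset.sum_fiberwise_of_maps_to (s := Finset.univ) (t := vertices P m)
    (g := fun p : Cell m × Fin 4 => corner P m p.1 p.2) (fun p _ => corner_mem P p.1 p.2) F

/-- Counting pairs (cell, corner) by vertex gives 2·#interior + 4 = 4·4^m. -/
theorem card_interior {P : Fin 4 → Space} (hP : AffineIndependent ℝ P) (m : ℕ) :
    (vertices P m \ vertices P 0).card = 2 * (4 ^ m - 1) := by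
  have h := sum_vertices_incidences P m fun _ => 1
  rw [← Finset.sum_sdiff (vertices_zero_subset P m),
    Finset.sum_congr rfl (g := fun _ => (2 : ℝ)) fun X hX => by
      rw [Finset.mem_sdiff] at hX
      rw [Finset.sum_const, (card_incidences hP m hX.1).2 hX.2]; norm_num,
    Finset.sum_congr (s₁ := vertices P 0) rfl (g := fun _ => (1 : ℝ)) fun X hX => by
      rw [Finset.sum_const, (card_incidences hP m (vertices_zero_subset P m hX)).1 hX]; norm_num]
    at h
  have h0 : (vertices P 0).card = 4 := by
    rw [vertices, Finset.card_image_of_injective _ hP.injective]; rfl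
  simp only [Finset.sum_const, h0, Finset.card_univ, card_cell, Fintype.card_fin, nsmul_eq_mul,
    mul_one] at h
  have h' : (vertices P m \ vertices P 0).card * 2 + 4 = 4 ^ m * 4 := by exact_mod_cast h
  omega

/-! ### The eigenvalue equation in terms of cell sums -/

/-- The sum of a function over the corners of a cell. -/
noncomputable def cellSum (P : Fin 4 → Space) (m : ℕ) (U : Space → ℝ) (c : Cell m) : ℝ :=
  ∑ j, U (corner P m c j)

/-- The Dirichlet eigenvalue equation of level `m`, written with sums over cells. -/
def IsEig (P : Fin 4 → Space) (m : ℕ) (lam : ℝ) (U : Space → ℝ) : Prop :=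
  (∀ X ∈ vertices P 0, U X = 0) ∧ ∀ X ∈ vertices P m, X ∉ vertices P 0 →
    (8 - lam) * U X = ∑ p ∈ incidences P m X, cellSum P m U p.1

theorem exists_extension (P : Fin 4 → Space) (m : ℕ) (u : vertices P m → ℝ) :
    ∃ U : Space → ℝ, u = fun X : vertices P m => U X := by
  classical
  exact ⟨fun X => if h : X ∈ vertices P m then u ⟨X, h⟩ else 0, by ext X; simp⟩

theorem adj_iff {P : Fin 4 → Space} {m : ℕ} {X Y : vertices P m} :
    (graph P m).Adj X Y ↔ X ≠ Y ∧ ∃ (c : Cell m) (j k : Fin 4),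
      (X : Space) = corner P m c j ∧ (Y : Space) = corner P m c k := by
  refine and_congr_right fun _ => ⟨?_, ?_⟩
  · rintro ⟨w, hw, j, k, hX, hY⟩
    obtain ⟨c, rfl⟩ := exists_word_eq w hw
    exact ⟨c, j, k, hX.trans (wordMap_word P c j), hY.trans (wordMap_word P c k)⟩
  · rintro ⟨c, j, k, hX, hY⟩
    exact ⟨c.word m, length_word c, j, k, hX.trans (wordMap_word P c j).symm,
      hY.trans (wordMap_word P c k).symm⟩

/-- Neighbours of X correspond bijectively to pairs of an incidence at X and another corner of its
cell; the corner X itself contributes zero and may be included. -/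
theorem laplacian_eq {P : Fin 4 → Space} (hP : AffineIndependent ℝ P) (m : ℕ) (U : Space → ℝ)
    (X : vertices P m) : laplacian P m (fun Y => U Y) X
      = ∑ p ∈ incidences P m X, (cellSum P m U p.1 - 4 * U X) := by
  classical
  have h1 : ∑ p ∈ incidences P m X, (cellSum P m U p.1 - 4 * U X)
      = ∑ q ∈ (incidences P m X ×ˢ Finset.univ).filter (fun q => q.2 ≠ q.1.2),
        (U (corner P m q.1.1 q.2) - U X) := by
    rw [Finset.sum_filter_of_ne, Finset.sum_product]
    · refine Finset.sum_congr rfl fun p _ => ?_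
      simp [cellSum, Finset.sum_sub_distrib]
    · intro q hq hne hk
      rw [Finset.mem_product, mem_incidences] at hq
      exact hne (by rw [hk, hq.1, sub_self])
  rw [h1, laplacian]
  symm
  refine Finset.sum_bij (fun q _ => (⟨corner P m q.1.1 q.2, corner_mem P _ _⟩ : vertices P m))
    ?_ ?_ ?_ ?_
  · rintro ⟨⟨c, j⟩, k⟩ hq
    simp only [Finset.mem_filter, Finset.mem_product, mem_incidences, Finset.mem_univ,
      and_true] at hq
    refine Finset.mem_filter.2 ⟨Finset.mem_univ _, adj_iff.2 ⟨fun h => hq.2 ?_, c, j, k,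
      hq.1.symm, rfl⟩⟩
    exact corner_injective hP c (by rw [hq.1, h])
  · rintro ⟨⟨c, j⟩, k⟩ hq ⟨⟨d, j'⟩, k'⟩ hq' h
    simp only [Finset.mem_filter, Finset.mem_product, mem_incidences, Finset.mem_univ,
      and_true] at hq hq'
    simp only [Subtype.mk.injEq] at h
    have hj := hq.1.trans hq'.1.symm
    obtain rfl := cell_eq_of_two_corners hP hq.2 h hj
    rw [corner_injective hP c h, corner_injective hP c hj]
  · rintro Y hY
    obtain ⟨hne, c, j, k, hX, hY⟩ := adj_iff.1 (Finset.mem_filter.1 hY).2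
    refine ⟨((c, j), k), ?_, Subtype.ext hY.symm⟩
    simp only [Finset.mem_filter, Finset.mem_product, mem_incidences, Finset.mem_univ, and_true]
    refine ⟨hX.symm, ?_⟩
    rintro rfl
    exact hne (Subtype.ext (hX.trans hY.symm))
  · intro q _
    rfl

theorem neg_laplacian_eq {P : Fin 4 → Space} (hP : AffineIndependent ℝ P) (m : ℕ) (U : Space → ℝ)
    (X : vertices P m) (hX : (X : Space) ∉ vertices P 0) : -laplacian P m (fun Y => U Y) X
      = 8 * U X - ∑ p ∈ incidences P m X, cellSum P m U p.1 := by
  rw [laplacian_eq hP, Finset.sum_sub_distrib, Finset.sum_const, (card_incidences hP m X.2).2 hX]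
  simp only [nsmul_eq_mul]
  push_cast
  ring

theorem mem_dirichletEigenspace_iff {P : Fin 4 → Space} (hP : AffineIndependent ℝ P) {m : ℕ}
    {lam : ℝ} {U : Space → ℝ} :
    (fun X : vertices P m => U X) ∈ dirichletEigenspace P m lam ↔ IsEig P m lam U := by
  constructor
  · rintro ⟨h0, h⟩
    refine ⟨fun X hX => h0 ⟨X, vertices_zero_subset P m hX⟩ hX, fun X hX hX0 => ?_⟩
    have := h ⟨X, hX⟩ hX0
    rw [neg_laplacian_eq hP m U ⟨X, hX⟩ hX0] at this
    simp only at this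
    linarith
  · rintro ⟨h0, h⟩
    refine ⟨fun X hX => h0 X hX, fun X hX => ?_⟩
    rw [neg_laplacian_eq hP m U X hX]
    linarith [h X X.2 hX]

/-! ### Spectral decimation -/

section decimation

variable {P : Fin 4 → Space} {m : ℕ} {lam : ℝ} {U : Space → ℝ}

theorem IsEig.midpoint (hP : AffineIndependent ℝ P) (h : IsEig P (m + 1) lam U) (c : Cell m)
    {i j : Fin 4} (hij : i ≠ j) : (8 - lam) * U (corner P (m + 1) (c.child i) j)
      = cellSum P (m + 1) U (c.child i) + cellSum P (m + 1) U (c.child j) := by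
  rw [h.2 _ (corner_mem P _ _) fun h0 =>
    corner_child_notMem hP c hij (vertices_zero_subset P m h0), sum_incidences_child hP c hij]

/-- Sum the midpoint equations over j ≠ i. The corner j = i is an old vertex, which the indicator
term accounts for. -/
theorem IsEig.cellSum_child (hP : AffineIndependent ℝ P) (h : IsEig P (m + 1) lam U) (c : Cell m)
    (i : Fin 4) : (6 - lam) * cellSum P (m + 1) U (c.child i)
      = (8 - lam) * U (corner P m c i) + ∑ k, cellSum P (m + 1) U (c.child k) := by
  have h1 : (8 - lam) * cellSum P (m + 1) U (c.child i)
      = ∑ j, (cellSum P (m + 1) U (c.child i) + cellSum P (m + 1) U (c.child j)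
        + if j = i then (8 - lam) * U (corner P m c i) - 2 * cellSum P (m + 1) U (c.child i)
          else 0) := by
    conv_lhs => rw [cellSum, Finset.mul_sum]
    refine Finset.sum_congr rfl fun j _ => ?_
    by_cases hij : j = i
    · subst hij
      rw [corner_child_self, if_pos rfl]
      ring
    · rw [if_neg hij, h.midpoint hP c (Ne.symm hij), add_zero]
  simp only [Finset.sum_add_distrib, Finset.sum_ite_eq', Finset.mem_univ, if_true,
    Finset.sum_const, Finset.card_univ, Fintype.card_fin, nsmul_eq_mul] at h1
  push_cast at h1
  linarith

theorem IsEig.sum_cellSum_child (hP : AffineIndependent ℝ P) (h : IsEig P (m + 1) lam U)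
    (c : Cell m) :
    (2 - lam) * ∑ k, cellSum P (m + 1) U (c.child k) = (8 - lam) * cellSum P m U c := by
  have h1 := Finset.sum_congr (s₁ := Finset.univ) rfl fun i _ => h.cellSum_child hP c i
  simp only [Finset.sum_add_distrib, ← Finset.mul_sum, Finset.sum_const, Finset.card_univ,
    Fintype.card_fin, nsmul_eq_mul] at h1
  push_cast at h1
  rw [cellSum]
  linarith

theorem IsEig.old_vertex (hP : AffineIndependent ℝ P) (h : IsEig P (m + 1) lam U) {X : Space}
    (hX : X ∈ vertices P m) (hX0 : X ∉ vertices P 0) : (4 - lam) * (8 - lam) * U X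
      = ∑ p ∈ incidences P m X, ∑ k, cellSum P (m + 1) U (p.1.child k) := by
  have h1 := h.2 X (vertices_subset_succ P m hX) hX0
  rw [sum_incidences_of_mem hP hX] at h1
  have h2 : (6 - lam) * ∑ p ∈ incidences P m X, cellSum P (m + 1) U (p.1.child p.2)
      = ∑ p ∈ incidences P m X, ((8 - lam) * U X
        + ∑ k, cellSum P (m + 1) U (p.1.child k)) := by
    rw [Finset.mul_sum]
    refine Finset.sum_congr rfl fun p hp => ?_
    rw [h.cellSum_child hP, mem_incidences.1 hp]
  rw [Finset.sum_add_distrib, Finset.sum_const, (card_incidences hP m hX).2 hX0, ← h1] at h2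
  simp only [nsmul_eq_mul] at h2
  push_cast at h2
  linarith

/-- Restricting an eigenfunction to the previous level. -/
theorem IsEig.decimate (hP : AffineIndependent ℝ P) (h : IsEig P (m + 1) lam U) (h8 : lam ≠ 8) :
    IsEig P m (lam * (6 - lam)) U := by
  refine ⟨h.1, fun X hX hX0 => ?_⟩
  -- The factor 2-λ turns each T(c) into (8-λ)S(c); then 8-λ cancels and (2-λ)(4-λ) = 8 - λ(6-λ).
  have h1 := congrArg (fun t => (2 - lam) * t) (h.old_vertex hP hX hX0)
  simp only [Finset.mul_sum] at h1
  simp only [← Finset.mul_sum, h.sum_cellSum_child hP] at h1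
  refine mul_left_cancel₀ (sub_ne_zero.2 h8.symm) ?_
  linarith

theorem IsEig.midpoint_eq (hP : AffineIndependent ℝ P) (h : IsEig P (m + 1) lam U) (c : Cell m)
    {i j : Fin 4} (hij : i ≠ j) :
    (6 - lam) * ((8 - lam) * U (corner P (m + 1) (c.child i) j))
      = (8 - lam) * (U (corner P m c i) + U (corner P m c j))
        + 2 * ∑ k, cellSum P (m + 1) U (c.child k) := by
  rw [h.midpoint hP c hij, mul_add, h.cellSum_child hP, h.cellSum_child hP]
  ring

theorem eq_zero_on_succ (hU : ∀ X ∈ vertices P m, U X = 0)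
    (h : ∀ (c : Cell m) (i j : Fin 4), i ≠ j → U (corner P (m + 1) (c.child i) j) = 0) :
    ∀ X ∈ vertices P (m + 1), U X = 0 := by
  intro X hX
  obtain ⟨e, j, rfl⟩ := (mem_vertices_iff P _ X).1 hX
  obtain ⟨c, i, rfl⟩ := e.exists_child
  by_cases hij : i = j
  · subst hij
    rw [corner_child_self]
    exact hU _ (corner_mem P c i)
  · exact h c i j hij

theorem IsEig.eq_zero_of_decimate (hP : AffineIndependent ℝ P) (h : IsEig P (m + 1) lam U)
    (h2 : lam ≠ 2) (h6 : lam ≠ 6) (h8 : lam ≠ 8) (hU : ∀ X ∈ vertices P m, U X = 0) :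
    ∀ X ∈ vertices P (m + 1), U X = 0 := by
  refine eq_zero_on_succ hU fun c i j hij => ?_
  have hT := h.sum_cellSum_child hP c
  rw [cellSum, Finset.sum_eq_zero fun j _ => hU _ (corner_mem P c j), mul_zero, mul_eq_zero] at hT
  have h1 := h.midpoint_eq hP c hij
  rw [hT.resolve_left (sub_ne_zero.2 h2.symm), hU _ (corner_mem P c i), hU _ (corner_mem P c j)]
    at h1
  simpa [sub_ne_zero.2 h6.symm, sub_ne_zero.2 h8.symm] using h1

/-- The extension of `U` from `V_m` to `V_{m+1}` given by spectral decimation. -/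
noncomputable def decimationExtension (P : Fin 4 → Space) (m : ℕ) (lam : ℝ) (U : Space → ℝ)
    (X : Space) : ℝ :=
  open Classical in
  if X ∈ vertices P m then U X else
    -- The value solves `IsEig.midpoint_eq` with T(c) = (8-λ)S(c)/(2-λ). Summing over both
    -- incidences avoids choosing a cell; the two terms agree, whence the 2 in the denominator.
    ∑ p ∈ incidences P (m + 1) X,
      (U (corner P m p.1.1 p.1.2) + U (corner P m p.1.1 p.2) + 2 * cellSum P m U p.1.1 / (2 - lam))
        / (2 * (6 - lam))

theorem decimationExtension_of_mem {X : Space} (hX : X ∈ vertices P m) :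
    decimationExtension P m lam U X = U X := if_pos hX

theorem decimationExtension_midpoint (hP : AffineIndependent ℝ P) (c : Cell m) {i j : Fin 4}
    (hij : i ≠ j) : decimationExtension P m lam U (corner P (m + 1) (c.child i) j)
      = (U (corner P m c i) + U (corner P m c j) + 2 * cellSum P m U c / (2 - lam))
        / (6 - lam) := by
  rw [decimationExtension, if_neg (corner_child_notMem hP c hij), sum_incidences_child hP c hij]
  simp only [Cell.child]
  rw [add_comm (U (corner P m c j)), ← two_mul, mul_comm 2 (6 - lam), ← div_div]
  ring

theorem cellSum_decimationExtension (hP : AffineIndependent ℝ P) (h2 : lam ≠ 2) (h6 : lam ≠ 6)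
    (c : Cell m) (i : Fin 4) :
    (6 - lam) * cellSum P (m + 1) (decimationExtension P m lam U) (c.child i)
      = (8 - lam) * (U (corner P m c i) + cellSum P m U c / (2 - lam)) := by
  have h1 : (6 - lam) * cellSum P (m + 1) (decimationExtension P m lam U) (c.child i)
      = ∑ j, (U (corner P m c i) + U (corner P m c j) + 2 * cellSum P m U c / (2 - lam)
        + if j = i then (6 - lam) * U (corner P m c i) - 2 * U (corner P m c i)
          - 2 * cellSum P m U c / (2 - lam) else 0) := by
    rw [cellSum, Finset.mul_sum]
    refine Finset.sum_congr rfl fun j _ => ?_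
    by_cases hij : j = i
    · subst hij
      rw [corner_child_self, if_pos rfl, decimationExtension_of_mem (corner_mem P c j)]
      ring
    · rw [if_neg hij, decimationExtension_midpoint hP c (Ne.symm hij), add_zero,
        mul_div_cancel₀ _ (sub_ne_zero.2 h6.symm)]
  rw [h1]
  simp only [Finset.sum_add_distrib, Finset.sum_ite_eq', Finset.mem_univ, if_true,
    Finset.sum_const, Finset.card_univ, Fintype.card_fin, nsmul_eq_mul]
  rw [← cellSum]
  have := sub_ne_zero.2 h2.symm
  push_cast
  field_simp
  ring

theorem IsEig.decimationExtension (hP : AffineIndependent ℝ P) (h2 : lam ≠ 2) (h6 : lam ≠ 6)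
    (h : IsEig P m (lam * (6 - lam)) U) :
    IsEig P (m + 1) lam (decimationExtension P m lam U) := by
  have h2' := sub_ne_zero.2 h2.symm
  have h6' := sub_ne_zero.2 h6.symm
  refine ⟨fun X hX => ?_, fun X hX hX0 => ?_⟩
  · rw [decimationExtension_of_mem (vertices_zero_subset P m hX), h.1 X hX]
  refine mul_left_cancel₀ h6' ?_
  by_cases hXm : X ∈ vertices P m
  · rw [decimationExtension_of_mem hXm, sum_incidences_of_mem hP hXm, Finset.mul_sum]
    simp only [cellSum_decimationExtension hP h2 h6]
    rw [← Finset.mul_sum, Finset.sum_add_distrib, ← Finset.sum_div, ← h.2 X hXm hX0,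
      Finset.sum_congr rfl (g := fun _ => U X) fun p hp => by rw [mem_incidences.1 hp],
      Finset.sum_const, (card_incidences hP m hXm).2 hX0]
    field_simp
    simp only [nsmul_eq_mul]
    push_cast
    ring
  · obtain ⟨e, j, rfl⟩ := (mem_vertices_iff P _ X).1 hX
    obtain ⟨c, i, rfl⟩ := e.exists_child
    have hij : i ≠ j := by
      rintro rfl
      rw [corner_child_self] at hXm
      exact hXm (corner_mem P c i)
    rw [sum_incidences_child hP c hij, mul_add, cellSum_decimationExtension hP h2 h6,
      cellSum_decimationExtension hP h2 h6, decimationExtension_midpoint hP c hij]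
    field_simp
    ring

/-- Any two siblings share a midpoint, so their values are opposite; three numbers with pairwise
sums zero all vanish. Sibling cells exist only from level one on. -/
theorem eq_zero_of_sum_incidences (hP : AffineIndependent ℝ P) {a : Cell (m + 1) → ℝ}
    (h : ∀ X ∈ vertices P (m + 1), X ∉ vertices P 0 → ∑ p ∈ incidences P (m + 1) X, a p.1 = 0) :
    a = 0 := by
  have key : ∀ (c : Cell m) {i j : Fin 4}, i ≠ j → a (c.child i) + a (c.child j) = 0 := by
    intro c i j hij
    rw [← h _ (corner_mem P (c.child i) j) fun h0 =>
      corner_child_notMem hP c hij (vertices_zero_subset P m h0), sum_incidences_child hP c hij]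
  funext e
  obtain ⟨c, i, rfl⟩ := e.exists_child
  obtain ⟨j, k, hij, hik, hjk⟩ : ∃ j k : Fin 4, i ≠ j ∧ i ≠ k ∧ j ≠ k := by
    revert i; decide
  have h1 := key c hij
  have h2 := key c hik
  have h3 := key c hjk
  simp only [Pi.zero_apply]
  linarith

/-- Summing over the corners of a cell and summing over the cells at a vertex are adjoint
operations. -/
theorem sum_mul_sum_incidences (P : Fin 4 → Space) (m : ℕ) (U : Space → ℝ) (a : Cell m → ℝ) :
    ∑ X ∈ vertices P m, U X * ∑ p ∈ incidences P m X, a p.1 = ∑ c, cellSum P m U c * a c := by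
  have h := sum_vertices_incidences P m fun p => U (corner P m p.1 p.2) * a p.1
  simp only [← Finset.sum_mul] at h
  rw [show ∑ c, cellSum P m U c * a c = _ from h.symm]
  refine Finset.sum_congr rfl fun X _ => ?_
  rw [Finset.mul_sum]
  exact Finset.sum_congr rfl fun p hp => by rw [mem_incidences.1 hp]

/-- `2` is not an eigenvalue beyond level one. -/
theorem IsEig.eq_zero_of_two (hP : AffineIndependent ℝ P) (h : IsEig P (m + 2) 2 U) :
    ∀ X ∈ vertices P (m + 2), U X = 0 := by
  set T : Cell (m + 1) → ℝ := fun c => ∑ k, cellSum P (m + 2) U (c.child k) with hT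
  have hS : ∀ c, cellSum P (m + 1) U c = 0 := fun c => by
    have := h.sum_cellSum_child hP c
    norm_num at this
    exact this
  have hold : ∀ X ∈ vertices P (m + 1), X ∉ vertices P 0 →
      ∑ p ∈ incidences P (m + 1) X, T p.1 = 12 * U X := fun X hX hX0 => by
    rw [hT, ← h.old_vertex hP hX hX0]
    norm_num
  -- As S = 0, adjointness gives 0 = ∑ S·T = 12 ∑ U², a sum of squares that kills U on the old
  -- vertices.
  have hsum := sum_mul_sum_incidences P (m + 1) U T
  simp only [hS, zero_mul, Finset.sum_const_zero] at hsum
  have hnn : ∀ X ∈ vertices P (m + 1), X ∉ vertices P 0 →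
      U X * ∑ p ∈ incidences P (m + 1) X, T p.1 = 12 * U X ^ 2 := fun X hX hX0 => by
    rw [hold X hX hX0]; ring
  have hU : ∀ X ∈ vertices P (m + 1), U X = 0 := by
    intro X hX
    by_cases hX0 : X ∈ vertices P 0
    · exact h.1 X hX0
    rw [Finset.sum_eq_zero_iff_of_nonneg] at hsum
    · have := hsum X hX
      rw [hnn X hX hX0] at this
      simpa using this
    · intro Y hY
      by_cases hY0 : Y ∈ vertices P 0
      · rw [h.1 Y hY0, zero_mul]
      · rw [hnn Y hY hY0]; positivity
  have hT0 : T = 0 := eq_zero_of_sum_incidences hP fun X hX hX0 => by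
    rw [hold X hX hX0, hU X hX, mul_zero]
  refine eq_zero_on_succ hU fun c i j hij => ?_
  have h1 := h.midpoint_eq hP c hij
  rw [hU _ (corner_mem P c i), hU _ (corner_mem P c j),
    show ∑ k, cellSum P (m + 2) U (c.child k) = 0 from congrFun hT0 c] at h1
  norm_num at h1
  exact h1

end decimation

/-! ### Symmetry and completeness -/

theorem finsum_finrank_eigenspace {E : Type*} [NormedAddCommGroup E] [InnerProductSpace ℝ E]
    [FiniteDimensional ℝ E] {T : E →ₗ[ℝ] E} (hT : T.IsSymmetric) :
    ∑ᶠ μ ∈ {μ | Module.End.eigenspace T μ ≠ ⊥}, Module.finrank ℝ (Module.End.eigenspace T μ)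
      = Module.finrank ℝ E := by
  classical
  have h := (LinearEquiv.ofBijective (DirectSum.coeLinearMap
    fun μ : Module.End.Eigenvalues T => Module.End.eigenspace T μ)
    hT.direct_sum_isInternal).finrank_eq
  rw [Module.finrank_directSum] at h
  rw [← h, ← finsum_set_coe_eq_finsum_mem]
  exact finsum_eq_sum_of_fintype (α := Module.End.Eigenvalues T)
    (fun μ => Module.finrank ℝ (Module.End.eigenspace T (μ : ℝ)))

variable {P : Fin 4 → Space}

theorem laplacian_add (m : ℕ) (u v : vertices P m → ℝ) (X : vertices P m) :
    laplacian P m (u + v) X = laplacian P m u X + laplacian P m v X := by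
  simp only [laplacian, ← Finset.sum_add_distrib, Pi.add_apply]
  exact Finset.sum_congr rfl fun Y _ => by ring

theorem laplacian_smul (m : ℕ) (r : ℝ) (u : vertices P m → ℝ) (X : vertices P m) :
    laplacian P m (r • u) X = r * laplacian P m u X := by
  simp only [laplacian, Finset.mul_sum, Pi.smul_apply, smul_eq_mul]
  exact Finset.sum_congr rfl fun Y _ => by ring

variable (P) in
/-- The functions vanishing on `V_0`, with the Euclidean inner product. -/
noncomputable def dirichletSpace (m : ℕ) : Submodule ℝ (EuclideanSpace ℝ (vertices P m)) :=
  (dirichletFunctions P m).comap (WithLp.linearEquiv 2 ℝ (vertices P m → ℝ)).toLinearMap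

variable (P) in
/-- The inclusion of `dirichletSpace` into the functions on `V_m`. -/
noncomputable def dirichletInclusion (m : ℕ) : dirichletSpace P m →ₗ[ℝ] (vertices P m → ℝ) :=
  (WithLp.linearEquiv 2 ℝ (vertices P m → ℝ)).toLinearMap ∘ₗ (dirichletSpace P m).subtype

theorem dirichletInclusion_injective (m : ℕ) : Function.Injective (dirichletInclusion P m) :=
  (WithLp.linearEquiv 2 ℝ (vertices P m → ℝ)).injective.comp Subtype.val_injective

theorem dirichletInclusion_mem {m : ℕ} (x : dirichletSpace P m) :
    dirichletInclusion P m x ∈ dirichletFunctions P m := x.2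

theorem exists_dirichletInclusion_eq {m : ℕ} {u : vertices P m → ℝ}
    (hu : u ∈ dirichletFunctions P m) : ∃ x, dirichletInclusion P m x = u :=
  ⟨⟨WithLp.toLp 2 u, hu⟩, rfl⟩

open Classical in
variable (P) in
/-- The operator `-Δ_m` on the functions vanishing on `V_0`. -/
noncomputable def dirichletOperator (m : ℕ) : dirichletSpace P m →ₗ[ℝ] dirichletSpace P m where
  toFun x := ⟨WithLp.toLp 2 fun X => if (X : Space) ∈ vertices P 0 then 0 else
    -laplacian P m (dirichletInclusion P m x) X, fun X hX => if_pos hX⟩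
  map_add' x y := by
    refine dirichletInclusion_injective m (funext fun X => ?_)
    change ite (X.1 ∈ vertices P 0) _ _ = (ite (X.1 ∈ vertices P 0) _ _ : ℝ) + ite (X.1 ∈ vertices P 0) _ _
    rw [map_add, laplacian_add]
    split_ifs <;> ring
  map_smul' r x := by
    refine dirichletInclusion_injective m (funext fun X => ?_)
    change ite (X.1 ∈ vertices P 0) _ _ = r * ite (X.1 ∈ vertices P 0) _ _
    rw [map_smul, laplacian_smul]
    split_ifs <;> ring

open Classical in
theorem dirichletInclusion_operator {m : ℕ} (x : dirichletSpace P m) (X : vertices P m) :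
    dirichletInclusion P m (dirichletOperator P m x) X =
      if (X : Space) ∈ vertices P 0 then 0 else -laplacian P m (dirichletInclusion P m x) X := rfl

theorem inner_dirichletSpace {m : ℕ} (x y : dirichletSpace P m) :
    inner ℝ x y = ∑ X, dirichletInclusion P m x X * dirichletInclusion P m y X := by
  rw [Submodule.coe_inner, PiLp.inner_apply]
  refine Finset.sum_congr rfl fun X _ => ?_
  rw [real_inner_comm]
  rfl

/-- By adjointness the form of -Δ is visibly symmetric in U and V. -/
theorem inner_dirichletOperator (hP : AffineIndependent ℝ P) {m : ℕ} (x y : dirichletSpace P m)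
    {U V : Space → ℝ} (hU : dirichletInclusion P m x = fun X : vertices P m => U X)
    (hV : dirichletInclusion P m y = fun X : vertices P m => V X) :
    inner ℝ (dirichletOperator P m x) y
      = 8 * (∑ X ∈ vertices P m, U X * V X) - ∑ c, cellSum P m V c * cellSum P m U c := by
  rw [inner_dirichletSpace, ← sum_mul_sum_incidences, Finset.mul_sum, ← Finset.sum_sub_distrib,
    ← Finset.sum_coe_sort (vertices P m)]
  refine Finset.sum_congr rfl fun X _ => ?_
  rw [dirichletInclusion_operator, hU, hV]
  split_ifs with h
  · have : V X = 0 := by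
      have := dirichletInclusion_mem y X h
      rwa [hV] at this
    rw [this]; ring
  · rw [neg_laplacian_eq hP m U X h]; ring

theorem dirichletOperator_isSymmetric (hP : AffineIndependent ℝ P) (m : ℕ) :
    (dirichletOperator P m).IsSymmetric := by
  intro x y
  obtain ⟨U, hU⟩ := exists_extension P m (dirichletInclusion P m x)
  obtain ⟨V, hV⟩ := exists_extension P m (dirichletInclusion P m y)
  rw [← real_inner_comm x, inner_dirichletOperator hP x y hU hV, inner_dirichletOperator hP y x hV hU]
  simp only [mul_comm]

theorem map_eigenspace (m : ℕ) (lam : ℝ) :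
    (Module.End.eigenspace (dirichletOperator P m) lam).map (dirichletInclusion P m)
      = dirichletEigenspace P m lam := by
  ext u
  rw [Submodule.mem_map]
  constructor
  · rintro ⟨x, hx, rfl⟩
    refine ⟨dirichletInclusion_mem x, fun X hX => ?_⟩
    rw [Module.End.mem_eigenspace_iff] at hx
    have := congrFun (congrArg (dirichletInclusion P m) hx) X
    rwa [dirichletInclusion_operator, if_neg hX, map_smul] at this
  · rintro ⟨hu, h⟩
    obtain ⟨x, rfl⟩ := exists_dirichletInclusion_eq hu
    refine ⟨x, ?_, rfl⟩
    rw [Module.End.mem_eigenspace_iff]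
    refine dirichletInclusion_injective m (funext fun X => ?_)
    rw [dirichletInclusion_operator, map_smul, Pi.smul_apply, smul_eq_mul]
    split_ifs with hX
    · rw [hu X hX, mul_zero]
    · exact h X hX

theorem map_dirichletSpace (m : ℕ) :
    (⊤ : Submodule ℝ (dirichletSpace P m)).map (dirichletInclusion P m)
      = dirichletFunctions P m := by
  ext u
  rw [Submodule.mem_map]
  constructor
  · rintro ⟨x, -, rfl⟩
    exact dirichletInclusion_mem x
  · intro hu
    obtain ⟨x, rfl⟩ := exists_dirichletInclusion_eq hu
    exact ⟨x, trivial, rfl⟩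

theorem iSup_dirichletEigenspace (hP : AffineIndependent ℝ P) (m : ℕ) :
    (⨆ lam : ℝ, dirichletEigenspace P m lam) = dirichletFunctions P m := by
  have h := (dirichletOperator_isSymmetric hP m).orthogonalComplement_iSup_eigenspaces_eq_bot
  rw [Submodule.orthogonal_eq_bot_iff] at h
  rw [← map_dirichletSpace, ← h, Submodule.map_iSup]
  simp only [map_eigenspace]

theorem finrank_eigenspace (m : ℕ) (lam : ℝ) :
    Module.finrank ℝ (Module.End.eigenspace (dirichletOperator P m) lam)
      = multiplicity P m lam := by
  rw [multiplicity, ← map_eigenspace]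
  exact (Submodule.equivMapOfInjective _ (dirichletInclusion_injective m) _).finrank_eq

theorem mem_dirichletSpectrum_iff {m : ℕ} {lam : ℝ} :
    lam ∈ dirichletSpectrum P m ↔ multiplicity P m lam ≠ 0 := by
  rw [multiplicity, Ne, Submodule.finrank_eq_zero, ← Ne, Submodule.ne_bot_iff]
  rfl

theorem dirichletSpectrum_eq (m : ℕ) : dirichletSpectrum P m
    = {lam | Module.End.eigenspace (dirichletOperator P m) lam ≠ ⊥} := by
  ext lam
  rw [mem_dirichletSpectrum_iff, ← finrank_eigenspace, Ne, Submodule.finrank_eq_zero]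
  rfl

theorem dirichletSpectrum_finite (m : ℕ) : (dirichletSpectrum P m).Finite := by
  rw [dirichletSpectrum_eq]
  exact Set.finite_coe_iff.1 (Finite.of_fintype (Module.End.Eigenvalues (dirichletOperator P m)))

theorem finrank_dirichletFunctions (hP : AffineIndependent ℝ P) (m : ℕ) :
    Module.finrank ℝ (dirichletFunctions P m) = 2 * (4 ^ m - 1) := by
  classical
  let f : dirichletFunctions P m ≃ₗ[ℝ] (↥(vertices P m \ vertices P 0) → ℝ) :=
    { toFun := fun u X => u.1 ⟨X, (Finset.mem_sdiff.1 X.2).1⟩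
      map_add' := fun _ _ => rfl
      map_smul' := fun _ _ => rfl
      invFun := fun f => ⟨fun X => if h : (X : Space) ∈ vertices P 0 then 0 else
        f ⟨X, Finset.mem_sdiff.2 ⟨X.2, h⟩⟩, fun X hX => dif_pos hX⟩
      left_inv := fun u => by
        ext X
        by_cases h : (X : Space) ∈ vertices P 0
        · simp only [dif_pos h, u.2 X h]
        · simp only [dif_neg h]
      right_inv := fun f => by
        ext X
        simp only [dif_neg (Finset.mem_sdiff.1 X.2).2] }
  rw [f.finrank_eq, Module.finrank_fintype_fun_eq_card, Fintype.card_coe, card_interior hP]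

theorem finsum_multiplicity (hP : AffineIndependent ℝ P) (m : ℕ) :
    ∑ᶠ lam ∈ dirichletSpectrum P m, multiplicity P m lam = 2 * (4 ^ m - 1) := by
  rw [← finrank_dirichletFunctions hP m, ← map_dirichletSpace,
    ← (Submodule.equivMapOfInjective _ (dirichletInclusion_injective m) _).finrank_eq, finrank_top,
    ← finsum_finrank_eigenspace (dirichletOperator_isSymmetric hP m), dirichletSpectrum_eq]
  simp only [finrank_eigenspace]

/-! ### The eigenvalue 8 -/

/-- The sums over cells of a function vanishing on `V_0`. -/
noncomputable def cellSums (P : Fin 4 → Space) (m : ℕ) : dirichletFunctions P m →ₗ[ℝ] (Cell m → ℝ) where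
  toFun u c := ∑ j, u.1 ⟨corner P m c j, corner_mem P c j⟩
  map_add' u v := by ext c; simp [Finset.sum_add_distrib]
  map_smul' r u := by ext c; simp [Finset.mul_sum]

/-- By duality: a functional vanishing on the range, tested on the indicator of an interior vertex,
has zero sum over the cells there, hence is zero. -/
theorem range_cellSums (hP : AffineIndependent ℝ P) (m : ℕ) :
    LinearMap.range (cellSums P (m + 1)) = ⊤ := by
  classical
  by_contra hne
  obtain ⟨f, hf, hle⟩ := Submodule.exists_le_ker_of_lt_top _ (lt_top_iff_ne_top.2 hne)
  refine hf ?_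
  have hfa : ∀ g, f g = ∑ c, g c * f (Pi.single c 1) := fun g => by
    conv_lhs => rw [pi_eq_sum_univ' g, map_sum]
    simp only [map_smul, smul_eq_mul]
  have ha : (fun c => f (Pi.single c 1)) = 0 := by
    refine eq_zero_of_sum_incidences hP fun X hX hX0 => ?_
    let U : Space → ℝ := fun Y => if Y = X then 1 else 0
    let u : dirichletFunctions P (m + 1) := ⟨fun Y => U Y, fun Y hY =>
      if_neg fun h : (Y : Space) = X => hX0 (h ▸ hY)⟩
    have h1 : f (cellSums P (m + 1) u) = 0 := hle ⟨u, rfl⟩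
    have h2 := sum_mul_sum_incidences P (m + 1) U fun c => f (Pi.single c 1)
    rw [hfa] at h1
    rw [show ∑ c, cellSum P (m + 1) U c * f (Pi.single c 1) = 0 from h1] at h2
    simpa [U, hX] using h2
  ext c
  simpa using congrFun ha c

/-- At λ = 8 the left side of the cell equation disappears, so `eq_zero_of_sum_incidences` applies
to the cell sums. -/
theorem map_ker_cellSums (hP : AffineIndependent ℝ P) (m : ℕ) :
    (LinearMap.ker (cellSums P (m + 1))).map (dirichletFunctions P (m + 1)).subtype
      = dirichletEigenspace P (m + 1) 8 := by
  ext u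
  obtain ⟨U, rfl⟩ := exists_extension P (m + 1) u
  rw [mem_dirichletEigenspace_iff hP, Submodule.mem_map]
  constructor
  · rintro ⟨u, hu, h⟩
    have hU : ∀ c, cellSum P (m + 1) U c = 0 := fun c => by
      refine Eq.trans ?_ (congrFun hu c)
      exact Finset.sum_congr rfl fun j _ => (congrFun h ⟨_, corner_mem P c j⟩).symm
    refine ⟨fun X hX => ?_, fun X _ _ => by simp [hU]⟩
    exact (congrFun h ⟨X, vertices_zero_subset P _ hX⟩).symm.trans
      (u.2 ⟨X, vertices_zero_subset P _ hX⟩ hX)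
  · rintro ⟨h0, h⟩
    refine ⟨⟨fun X => U X, fun X hX => h0 X hX⟩, ?_, rfl⟩
    have := eq_zero_of_sum_incidences hP (a := cellSum P (m + 1) U) fun X hX hX0 => by
      rw [← h X hX hX0]; ring
    exact this

theorem multiplicity_eight (hP : AffineIndependent ℝ P) (m : ℕ) :
    multiplicity P (m + 1) 8 = 4 ^ (m + 1) - 2 := by
  have h := (cellSums P (m + 1)).finrank_range_add_finrank_ker
  rw [range_cellSums hP, finrank_top, Module.finrank_fintype_fun_eq_card, card_cell,
    finrank_dirichletFunctions hP] at h
  rw [multiplicity, ← map_ker_cellSums hP,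
    ← (Submodule.equivMapOfInjective _ Subtype.val_injective _).finrank_eq]
  have : 1 ≤ 4 ^ m := Nat.one_le_pow _ _ (by norm_num)
  rw [pow_succ] at *
  omega

/-! ### Decimation of multiplicities and spectra -/

theorem bijOn_restrict (hP : AffineIndependent ℝ P) (m : ℕ) {lam : ℝ} (h2 : lam ≠ 2)
    (h6 : lam ≠ 6) (h8 : lam ≠ 8) :
    Set.BijOn (restrict P m) (dirichletEigenspace P (m + 1) lam)
      (dirichletEigenspace P m (lam * (6 - lam))) := by
  refine ⟨fun u hu => ?_, fun u hu v hv huv => ?_, fun u hu => ?_⟩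
  · obtain ⟨U, rfl⟩ := exists_extension P (m + 1) u
    exact (mem_dirichletEigenspace_iff hP).2
      (((mem_dirichletEigenspace_iff hP).1 hu).decimate hP h8)
  · obtain ⟨U, hU⟩ := exists_extension P (m + 1) (u - v)
    have h := Submodule.sub_mem _ hu hv
    rw [hU] at h
    have h0 := ((mem_dirichletEigenspace_iff hP).1 h).eq_zero_of_decimate hP h2 h6 h8
      fun X hX => by
        rw [← congrFun hU ⟨X, vertices_subset_succ P m hX⟩]
        exact sub_eq_zero.2 (congrFun huv ⟨X, hX⟩)
    rw [← sub_eq_zero, hU]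
    exact funext fun X => h0 X X.2
  · obtain ⟨U, rfl⟩ := exists_extension P m u
    refine ⟨fun X => decimationExtension P m lam U X, ?_, ?_⟩
    · exact (mem_dirichletEigenspace_iff hP).2
        (((mem_dirichletEigenspace_iff hP).1 hu).decimationExtension hP h2 h6)
    · exact funext fun X => decimationExtension_of_mem X.2

theorem multiplicity_decimation (hP : AffineIndependent ℝ P) (m : ℕ) {lam : ℝ} (h2 : lam ≠ 2)
    (h6 : lam ≠ 6) (h8 : lam ≠ 8) :
    multiplicity P (m + 1) lam = multiplicity P m (lam * (6 - lam)) := by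
  have h := bijOn_restrict hP m h2 h6 h8
  let R : (vertices P (m + 1) → ℝ) →ₗ[ℝ] (vertices P m → ℝ) :=
    { toFun := restrict P m, map_add' := fun _ _ => rfl, map_smul' := fun _ _ => rfl }
  exact (LinearEquiv.ofBijective (R.restrict h.mapsTo) h.bijective).finrank_eq

theorem two_notMem_dirichletSpectrum (hP : AffineIndependent ℝ P) (m : ℕ) :
    (2 : ℝ) ∉ dirichletSpectrum P (m + 2) := by
  rintro ⟨u, hu, hne⟩
  obtain ⟨U, rfl⟩ := exists_extension P (m + 2) u
  exact hne (funext fun X => ((mem_dirichletEigenspace_iff hP).1 hu).eq_zero_of_two hP X X.2)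

theorem dirichletSpectrum_zero : dirichletSpectrum P 0 = ∅ := by
  refine Set.eq_empty_of_forall_notMem ?_
  rintro lam ⟨u, hu, hne⟩
  exact hne (funext fun X => hu.1 X X.2)

theorem multiplicity_one_two (hP : AffineIndependent ℝ P) : multiplicity P 1 2 = 1 := by
  classical
  let V : Space → ℝ := fun X => if X ∈ vertices P 0 then 0 else 1
  have hV : ∀ (c : Cell 0) (i j : Fin 4), V (corner P 1 (c.child i) j) = if j = i then 0 else 1 := by
    intro c i j
    by_cases hij : j = i
    · subst hij
      rw [corner_child_self, if_pos rfl]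
      exact if_pos (corner_mem P c j)
    · rw [if_neg hij]
      exact if_neg (corner_child_notMem hP c (Ne.symm hij))
  have hS : ∀ (c : Cell 0) (i : Fin 4), cellSum P 1 V (c.child i) = 3 := by
    intro c i
    simp only [cellSum, hV]
    simp [Finset.sum_ite, Finset.filter_ne']
  have hmid : ∀ X ∈ vertices P 1, X ∉ vertices P 0 → ∃ (c : Cell 0) (i j : Fin 4), i ≠ j ∧
      X = corner P 1 (c.child i) j := by
    intro X hX hX0
    obtain ⟨e, j, rfl⟩ := (mem_vertices_iff P 1 X).1 hX
    obtain ⟨c, i, rfl⟩ := e.exists_child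
    refine ⟨c, i, j, ?_, rfl⟩
    rintro rfl
    rw [corner_child_self] at hX0
    exact hX0 (corner_mem P c i)
  have hE : IsEig P 1 2 V := by
    refine ⟨fun X hX => if_pos hX, fun X hX hX0 => ?_⟩
    rw [show V X = 1 from if_neg hX0]
    obtain ⟨c, i, j, hij, rfl⟩ := hmid X hX hX0
    rw [sum_incidences_child hP c hij, hS, hS]
    norm_num
  refine finrank_eq_one (⟨fun X => V X, (mem_dirichletEigenspace_iff hP).2 hE⟩ :
    dirichletEigenspace P 1 2) ?_ ?_
  · intro h
    have hX := congrFun (congrArg Subtype.val h) ⟨_, corner_mem P (Cell.child (m := 0) () 0) 1⟩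
    refine one_ne_zero (α := ℝ) (Eq.trans ?_ hX)
    exact (hV _ 0 1).symm
  · rintro ⟨u, hu⟩
    obtain ⟨U, rfl⟩ := exists_extension P 1 u
    have hU := (mem_dirichletEigenspace_iff hP).1 hu
    -- With zero boundary values and λ = 2, `IsEig.midpoint_eq` reads 24u = 2T, so u is the constant
    -- T/12 on the interior.
    refine ⟨(∑ k, cellSum P 1 U (Cell.child (m := 0) () k)) / 12, Subtype.ext (funext ?_)⟩
    rintro ⟨X, hX⟩
    change _ * V X = U X
    by_cases hX0 : X ∈ vertices P 0
    · rw [hU.1 X hX0, show V X = 0 from if_pos hX0, mul_zero]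
    · rw [show V X = 1 from if_neg hX0]
      obtain ⟨c, i, j, hij, rfl⟩ := hmid X hX hX0
      have := hU.midpoint_eq hP c hij
      rw [hU.1 _ (corner_mem P c i), hU.1 _ (corner_mem P c j)] at this
      obtain rfl : c = () := rfl
      linarith

/-- Level zero has no eigenvalues, and λ(6-λ) > 0 forces 0 < λ < 6 for the unexceptional λ. -/
theorem dirichletSpectrum_bounds (hP : AffineIndependent ℝ P) (m : ℕ) {mu : ℝ}
    (h : mu ∈ dirichletSpectrum P m) : 0 < mu ∧ mu ≤ 8 := by
  induction m generalizing mu with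
  | zero => simp [dirichletSpectrum_zero] at h
  | succ m ih =>
    by_cases h2 : mu = 2
    · subst h2; norm_num
    by_cases h6 : mu = 6
    · subst h6; norm_num
    by_cases h8 : mu = 8
    · subst h8; norm_num
    rw [mem_dirichletSpectrum_iff, multiplicity_decimation hP m h2 h6 h8,
      ← mem_dirichletSpectrum_iff] at h
    have := (ih h).1
    constructor <;> nlinarith

/-- The roots 3 ± √(9-μ) thus lie in [4, 6) and (0, 2], meeting an exceptional value only at 2, for
μ = 8. -/
theorem one_le_sqrt_lt_three {mu : ℝ} (h : 0 < mu ∧ mu ≤ 8) :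
    1 ≤ √(9 - mu) ∧ √(9 - mu) < 3 ∧ √(9 - mu) ^ 2 = 9 - mu ∧ (mu ≠ 8 → 1 < √(9 - mu)) := by
  refine ⟨Real.le_sqrt_of_sq_le (by linarith), (Real.sqrt_lt' (by norm_num)).2 (by linarith),
    Real.sq_sqrt (by linarith), fun h8 => Real.lt_sqrt_of_sq_lt ?_⟩
  have := lt_of_le_of_ne h.2 h8
  linarith

theorem multiplicity_add_sqrt (hP : AffineIndependent ℝ P) {m : ℕ} {mu : ℝ}
    (h : mu ∈ dirichletSpectrum P m) :
    multiplicity P (m + 1) (3 + √(9 - mu)) = multiplicity P m mu := by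
  obtain ⟨h1, h3, hsq, -⟩ := one_le_sqrt_lt_three (dirichletSpectrum_bounds hP m h)
  rw [multiplicity_decimation hP m (by linarith) (by linarith) (by linarith)]
  congr 1
  linarith

theorem multiplicity_sub_sqrt (hP : AffineIndependent ℝ P) {m : ℕ} {mu : ℝ}
    (h : mu ∈ dirichletSpectrum P m) (h8 : mu ≠ 8) :
    multiplicity P (m + 1) (3 - √(9 - mu)) = multiplicity P m mu := by
  obtain ⟨h1, h3, hsq, hlt⟩ := one_le_sqrt_lt_three (dirichletSpectrum_bounds hP m h)
  have := hlt h8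
  rw [multiplicity_decimation hP m (by linarith) (by linarith) (by linarith)]
  congr 1
  linarith

theorem eq_add_sqrt_or_eq_sub_sqrt {lam mu : ℝ} (h : lam * (6 - lam) = mu) :
    lam = 3 + √(9 - mu) ∨ lam = 3 - √(9 - mu) := by
  have h1 : 9 - mu = (lam - 3) ^ 2 := by rw [← h]; ring
  rw [h1, Real.sqrt_sq_eq_abs]
  rcases abs_choice (lam - 3) with h | h <;> rw [h]
  · left; ring
  · right; ring

theorem dirichletSpectrum_sdiff (hP : AffineIndependent ℝ P) (m : ℕ) :
    dirichletSpectrum P (m + 2) \ {6, 8}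
      = (fun mu => 3 + √(9 - mu)) '' dirichletSpectrum P (m + 1) ∪
        (fun mu => 3 - √(9 - mu)) '' (dirichletSpectrum P (m + 1) \ {8}) := by
  ext lam
  constructor
  · rintro ⟨h, hne⟩
    simp only [Set.mem_insert_iff, Set.mem_singleton_iff, not_or] at hne
    have h2 : lam ≠ 2 := fun h2 => two_notMem_dirichletSpectrum hP m (h2 ▸ h)
    rw [mem_dirichletSpectrum_iff, multiplicity_decimation hP _ h2 hne.1 hne.2,
      ← mem_dirichletSpectrum_iff] at h
    rcases eq_add_sqrt_or_eq_sub_sqrt (lam := lam) rfl with h' | h'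
    · exact Or.inl ⟨_, h, h'.symm⟩
    · refine Or.inr ⟨_, ⟨h, fun h8 => h2 ?_⟩, h'.symm⟩
      rw [Set.mem_singleton_iff] at h8
      rw [h', h8]
      norm_num
  · rintro (⟨mu, h, rfl⟩ | ⟨mu, ⟨h, h8⟩, rfl⟩)
    · obtain ⟨h1, h3, -, -⟩ := one_le_sqrt_lt_three (dirichletSpectrum_bounds hP _ h)
      refine ⟨?_, ?_⟩
      · rw [mem_dirichletSpectrum_iff] at h ⊢
        rwa [multiplicity_add_sqrt hP (mem_dirichletSpectrum_iff.2 h)]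
      · rintro (h' | h')
        · simp only at h'; linarith
        · simp only [Set.mem_singleton_iff] at h'; linarith
    · obtain ⟨h1, h3, -, -⟩ := one_le_sqrt_lt_three (dirichletSpectrum_bounds hP _ h)
      refine ⟨?_, ?_⟩
      · rw [mem_dirichletSpectrum_iff] at h ⊢
        rwa [multiplicity_sub_sqrt hP (mem_dirichletSpectrum_iff.2 h) h8]
      · rintro (h' | h')
        · simp only at h'; linarith
        · simp only [Set.mem_singleton_iff] at h'; linarith

/-! ### Counting multiplicities and the eigenvalue 6 -/

/-- Allows 6 to be listed in the sum before it is known to be an eigenvalue. -/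
theorem finsum_multiplicity_of_subset {m : ℕ} {s : Set ℝ} (hs : dirichletSpectrum P m ⊆ s) :
    ∑ᶠ lam ∈ s, multiplicity P m lam = ∑ᶠ lam ∈ dirichletSpectrum P m, multiplicity P m lam :=
  finsum_mem_inter_support_eq' _ _ _ fun _ hx =>
    ⟨fun _ => mem_dirichletSpectrum_iff.2 hx, fun h => hs h⟩

theorem four_pow_pos (m : ℕ) : 1 ≤ 4 ^ m := Nat.one_le_pow _ _ (by norm_num)

theorem finsum_multiplicity_sdiff_eight (hP : AffineIndependent ℝ P) (m : ℕ) :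
    ∑ᶠ mu ∈ dirichletSpectrum P (m + 1) \ {8}, multiplicity P (m + 1) mu = 4 ^ (m + 1) := by
  have h := finsum_multiplicity hP (m + 1)
  rw [← finsum_multiplicity_of_subset (s := insert 8 (dirichletSpectrum P (m + 1) \ {8}))
    (by simp), finsum_mem_insert _ (by simp) ((dirichletSpectrum_finite _).sdiff),
    multiplicity_eight hP] at h
  have := four_pow_pos m
  rw [pow_succ] at *
  omega

/-- With n = 4^(m+1), the upper roots contribute the full 2(n-1), the lower ones only n, since μ = 8
is left out. -/
theorem finsum_multiplicity_sdiff_six_eight (hP : AffineIndependent ℝ P) (m : ℕ) :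
    ∑ᶠ lam ∈ dirichletSpectrum P (m + 2) \ {6, 8}, multiplicity P (m + 2) lam
      = (4 ^ (m + 1) - 2) + 2 * 4 ^ (m + 1) := by
  have hfin := dirichletSpectrum_finite (P := P) (m + 1)
  have hinj : ∀ {mu nu : ℝ}, mu ∈ dirichletSpectrum P (m + 1) →
      nu ∈ dirichletSpectrum P (m + 1) → √(9 - mu) = √(9 - nu) → mu = nu := by
    intro mu nu hmu hnu h
    have h1 := (one_le_sqrt_lt_three (dirichletSpectrum_bounds hP _ hmu)).2.2.1
    have h2 := (one_le_sqrt_lt_three (dirichletSpectrum_bounds hP _ hnu)).2.2.1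
    rw [h, h2] at h1
    linarith
  rw [dirichletSpectrum_sdiff hP, finsum_mem_union _ (hfin.image _) (hfin.sdiff.image _),
    finsum_mem_image, finsum_mem_image,
    finsum_mem_congr rfl fun mu hmu => multiplicity_add_sqrt hP hmu,
    finsum_mem_congr rfl fun mu hmu => multiplicity_sub_sqrt hP hmu.1 hmu.2,
    finsum_multiplicity hP, finsum_multiplicity_sdiff_eight hP]
  · have := four_pow_pos m
    rw [pow_succ]
    omega
  · intro mu hmu nu hnu h
    exact hinj hmu.1 hnu.1 (by simpa using h)
  · intro mu hmu nu hnu h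
    exact hinj hmu hnu (by simpa using h)
  · rw [Set.disjoint_left]
    rintro _ ⟨mu, hmu, rfl⟩ ⟨nu, hnu, h⟩
    have h1 := (one_le_sqrt_lt_three (dirichletSpectrum_bounds hP _ hmu)).1
    have h2 := (one_le_sqrt_lt_three (dirichletSpectrum_bounds hP _ hnu.1)).1
    simp only at h
    linarith

/-- With n = 4^(m+1), what remains is 2(4n-1) - (4n-2) - (3n-2) = n + 2. -/
theorem multiplicity_six (hP : AffineIndependent ℝ P) (m : ℕ) :
    multiplicity P (m + 2) 6 = 4 ^ (m + 1) + 2 := by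
  have h := finsum_multiplicity hP (m + 2)
  have hfin := (dirichletSpectrum_finite (P := P) (m + 2)).sdiff (t := {6, 8})
  rw [← finsum_multiplicity_of_subset
    (s := insert 6 (insert 8 (dirichletSpectrum P (m + 2) \ {6, 8}))), finsum_mem_insert,
    finsum_mem_insert, finsum_multiplicity_sdiff_six_eight hP, multiplicity_eight hP] at h
  · have := four_pow_pos m
    rw [pow_succ, pow_succ] at *
    omega
  · simp
  · exact hfin
  · norm_num
  · exact hfin.insert 8
  · intro x hx
    simp only [Set.mem_insert_iff, Set.mem_sdiff, Set.mem_singleton_iff]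
    tauto

/-! ### The spectra of levels one and two -/

theorem dirichletSpectrum_one_subset (hP : AffineIndependent ℝ P) :
    dirichletSpectrum P 1 ⊆ {2, 8, 6} := by
  intro lam h
  by_contra hne
  simp only [Set.mem_insert_iff, Set.mem_singleton_iff, not_or] at hne
  rw [mem_dirichletSpectrum_iff, multiplicity_decimation hP 0 hne.1 hne.2.2 hne.2.1,
    ← mem_dirichletSpectrum_iff, dirichletSpectrum_zero] at h
  exact h

theorem multiplicity_one_six (hP : AffineIndependent ℝ P) : multiplicity P 1 6 = 3 := by
  have h := finsum_multiplicity hP 1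
  have h8 := multiplicity_eight hP 0
  rw [← finsum_multiplicity_of_subset (dirichletSpectrum_one_subset hP),
    finsum_mem_insert _ (by norm_num) (Set.toFinite _), finsum_mem_pair (by norm_num),
    multiplicity_one_two hP] at h
  norm_num at h h8
  omega

theorem dirichletSpectrum_one (hP : AffineIndependent ℝ P) :
    dirichletSpectrum P 1 = {2, 8, 6} := by
  refine (dirichletSpectrum_one_subset hP).antisymm ?_
  rintro lam (rfl | rfl | rfl) <;> rw [mem_dirichletSpectrum_iff]
  · rw [multiplicity_one_two hP]; norm_num
  · rw [multiplicity_eight hP 0]; norm_num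
  · rw [multiplicity_one_six hP]; norm_num

theorem dirichletSpectrum_succ (hP : AffineIndependent ℝ P) (m : ℕ) :
    dirichletSpectrum P (m + 2) = {6, 8} ∪
      {lam | lam ≠ 2 ∧ ∃ mu ∈ dirichletSpectrum P (m + 1),
        lam = 3 + √(9 - mu) ∨ lam = 3 - √(9 - mu)} := by
  have h68 : ({6, 8} : Set ℝ) ⊆ dirichletSpectrum P (m + 2) := by
    have := four_pow_pos m
    rintro lam (rfl | rfl) <;> rw [mem_dirichletSpectrum_iff]
    · rw [multiplicity_six hP]; omega
    · rw [multiplicity_eight hP, pow_succ, pow_succ]; omega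
  rw [← Set.union_sdiff_cancel h68, dirichletSpectrum_sdiff hP]
  congr 1
  ext lam
  constructor
  · rintro (⟨mu, h, rfl⟩ | ⟨mu, ⟨h, h8⟩, rfl⟩)
    · have h1 := (one_le_sqrt_lt_three (dirichletSpectrum_bounds hP _ h)).1
      exact ⟨ne_of_gt (by linarith), mu, h, Or.inl rfl⟩
    · have h1 := (one_le_sqrt_lt_three (dirichletSpectrum_bounds hP _ h)).2.2.2 h8
      exact ⟨ne_of_lt (by linarith), mu, h, Or.inr rfl⟩
  · rintro ⟨h2, mu, h, rfl | rfl⟩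
    · exact Or.inl ⟨mu, h, rfl⟩
    · refine Or.inr ⟨mu, ⟨h, ?_⟩, rfl⟩
      rintro rfl
      norm_num at h2

theorem dirichletSpectrum_two (hP : AffineIndependent ℝ P) :
    dirichletSpectrum P 2 = {6, 8, 3 - √7, 3 + √7, 3 - √3, 3 + √3, 4} := by
  have h3 : 1 < √3 := Real.lt_sqrt_of_sq_lt (by norm_num)
  have h7 : 1 < √7 := Real.lt_sqrt_of_sq_lt (by norm_num)
  rw [dirichletSpectrum_succ hP 0, dirichletSpectrum_one hP]
  ext lam
  simp only [Set.mem_union, Set.mem_insert_iff, Set.mem_singleton_iff, Set.mem_ofPred_eq,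
    exists_eq_or_imp, exists_eq_left, show (9 : ℝ) - 2 = 7 by norm_num,
    show (9 : ℝ) - 8 = 1 by norm_num, show (9 : ℝ) - 6 = 3 by norm_num, Real.sqrt_one,
    show (3 : ℝ) + 1 = 4 by norm_num, show (3 : ℝ) - 1 = 2 by norm_num]
  constructor
  · rintro ((h | h) | ⟨h2, (h | h) | (h | h) | h | h⟩)
    all_goals first | exact absurd h h2 | simp only [h, true_or, or_true]
  · rintro (h | h | h | h | h | h | h)
    · exact Or.inl (Or.inl h)
    · exact Or.inl (Or.inr h)
    · exact Or.inr ⟨ne_of_lt (by linarith), Or.inl (Or.inr h)⟩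
    · exact Or.inr ⟨ne_of_gt (by linarith), Or.inl (Or.inl h)⟩
    · exact Or.inr ⟨ne_of_lt (by linarith), Or.inr (Or.inr (Or.inr h))⟩
    · exact Or.inr ⟨ne_of_gt (by linarith), Or.inr (Or.inr (Or.inl h))⟩
    · exact Or.inr ⟨ne_of_gt (by linarith), Or.inr (Or.inl (Or.inl h))⟩

end SierpinskiTetrahedron

theorem mainTheorem2 (P : Fin 4 → SierpinskiTetrahedron.Space) (hP : AffineIndependent ℝ P) :
    open SierpinskiTetrahedron in
    -- every level `m ≥ 1`: number of interior vertices, completeness, exceptional eigenvalues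
    (∀ m : ℕ, 1 ≤ m →
      (↑(vertices P m) \ ↑(vertices P 0) : Set Space).ncard = 2 * (4 ^ m - 1) ∧
      (⨆ lam : ℝ, dirichletEigenspace P m lam) = dirichletFunctions P m ∧
      (dirichletSpectrum P m).Finite ∧
      ∑ᶠ lam ∈ dirichletSpectrum P m, multiplicity P m lam = 2 * (4 ^ m - 1) ∧
      multiplicity P m 8 = 4 ^ m - 2 ∧
      multiplicity P m 6 = 4 ^ (m - 1) + 2 ∧
      (2 ∈ dirichletSpectrum P m ↔ m = 1)) ∧
    -- spectral decimation, from level `m ≥ 1` to level `m + 1`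
    (∀ m : ℕ, 1 ≤ m →
      (∀ lam : ℝ, lam ≠ 2 → lam ≠ 6 → lam ≠ 8 →
        Set.BijOn (restrict P m) (dirichletEigenspace P (m + 1) lam)
          (dirichletEigenspace P m (lam * (6 - lam))) ∧
        multiplicity P (m + 1) lam = multiplicity P m (lam * (6 - lam))) ∧
      (∀ mu ∈ dirichletSpectrum P m, mu < 9 ∧
        multiplicity P (m + 1) (3 + √(9 - mu)) = multiplicity P m mu ∧
        (mu ≠ 8 → multiplicity P (m + 1) (3 - √(9 - mu)) = multiplicity P m mu)) ∧
      dirichletSpectrum P (m + 1) = {6, 8} ∪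
        {lam | lam ≠ 2 ∧ ∃ mu ∈ dirichletSpectrum P m,
          lam = 3 + √(9 - mu) ∨ lam = 3 - √(9 - mu)} ∧
      ∑ᶠ mu ∈ dirichletSpectrum P m \ {8}, multiplicity P m mu = 4 ^ m ∧
      ∑ᶠ lam ∈ dirichletSpectrum P (m + 1) \ {6, 8}, multiplicity P (m + 1) lam =
        (4 ^ m - 2) + 2 * 4 ^ m) ∧
    -- level 1
    (dirichletSpectrum P 1 = {2, 8, 6} ∧
      multiplicity P 1 2 = 1 ∧ multiplicity P 1 8 = 2 ∧ multiplicity P 1 6 = 3) ∧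
    -- level 2
    (dirichletSpectrum P 2 = {6, 8, 3 - √7, 3 + √7, 3 - √3, 3 + √3, 4} ∧
      multiplicity P 2 6 = 6 ∧ multiplicity P 2 8 = 14 ∧
      multiplicity P 2 (3 - √7) = 1 ∧ multiplicity P 2 (3 + √7) = 1 ∧
      multiplicity P 2 (3 - √3) = 3 ∧ multiplicity P 2 (3 + √3) = 3 ∧
      multiplicity P 2 4 = 2) := by
  open SierpinskiTetrahedron in
  refine ⟨?_, ?_, ⟨dirichletSpectrum_one hP, multiplicity_one_two hP, multiplicity_eight hP 0,
    multiplicity_one_six hP⟩, dirichletSpectrum_two hP, multiplicity_six hP 0,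
    multiplicity_eight hP 1, ?_⟩
  · intro m hm
    obtain ⟨m, rfl⟩ := Nat.exists_eq_add_of_le' hm
    refine ⟨?_, iSup_dirichletEigenspace hP _, dirichletSpectrum_finite _,
      finsum_multiplicity hP _, multiplicity_eight hP m, ?_, ?_⟩
    · classical
      rw [← Finset.coe_sdiff, Set.ncard_coe_finset, card_interior hP]
    · cases m with
      | zero => exact multiplicity_one_six hP
      | succ m => exact multiplicity_six hP m
    · cases m with
      | zero => simp [dirichletSpectrum_one hP]
      | succ m => simp [two_notMem_dirichletSpectrum hP m]
  · intro m hm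
    obtain ⟨m, rfl⟩ := Nat.exists_eq_add_of_le' hm
    refine ⟨fun lam h2 h6 h8 => ⟨bijOn_restrict hP _ h2 h6 h8,
      multiplicity_decimation hP _ h2 h6 h8⟩, fun mu hmu => ⟨?_, multiplicity_add_sqrt hP hmu,
      multiplicity_sub_sqrt hP hmu⟩, dirichletSpectrum_succ hP m,
      finsum_multiplicity_sdiff_eight hP m, finsum_multiplicity_sdiff_six_eight hP m⟩
    have := (dirichletSpectrum_bounds hP _ hmu).2
    linarith
  -- Three eigenvalues of level one give five here: the lower root for μ = 8 is the forbidden value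
  -- 2.
  · have hσ := dirichletSpectrum_one hP
    have h2 : (2 : ℝ) ∈ dirichletSpectrum P 1 := by simp [hσ]
    have h6 : (6 : ℝ) ∈ dirichletSpectrum P 1 := by simp [hσ]
    have h8 : (8 : ℝ) ∈ dirichletSpectrum P 1 := by simp [hσ]
    have a := multiplicity_sub_sqrt hP h2 (by norm_num)
    have b := multiplicity_add_sqrt hP h2
    have c := multiplicity_sub_sqrt hP h6 (by norm_num)
    have d := multiplicity_add_sqrt hP h6
    have e := multiplicity_add_sqrt hP h8
    rw [multiplicity_one_two hP, show (9 : ℝ) - 2 = 7 by norm_num] at a b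
    rw [multiplicity_one_six hP, show (9 : ℝ) - 6 = 3 by norm_num] at c d
    rw [multiplicity_eight hP 0, show (9 : ℝ) - 8 = 1 by norm_num, Real.sqrt_one,
      show (3 : ℝ) + 1 = 4 by norm_num] at e
    exact ⟨a, b, c, d, e⟩
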